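/- Let $\Omega\subset\mathbb{R}^d$ be a bounded open set with $C^2$ boundary, i.e. every $p\in\partial\Omega$ has a neighbourhood $U$ and a $C^2$ function $\varphi:U\to\mathbb{R}$ with $\varphi(p)=0$, $\nabla\varphi(p)\neq 0$ and $\Omega\cap U=\{x\in U:\varphi(x)<0\}$; the outward unit normal at $p$ is $\nabla\varphi(p)/\|\nabla\varphi(p)\|$. Then there are constants $C>0$ and $h_0>0$, depending only on $\Omega$, such that the following holds for every $0<h\le h_0$. Let $K^1,\dots,K^m$ be a finite mesh of measurable elements (subelements, if the elements have been subdivided) that overlap only in null sets and cover $\Omega$ up to a null set, and let each $K^e$ have a centroid $x_e$ in its convex hull. Suppose that every $K^e$ has diameter at most $h$; elements contained in the open ball about $x_e$ of radius $\operatorname{dist}(x_e,\partial\Omega)$, which adaptive subdivision does not subdivide further, may be of any size. For every $e$ let $x_p^e\in\partial\Omega$ be a boundary point closest to $x_e$ (any one, if there are several), let $n_p^e$ be the outward unit normal to $\Omega$ at $x_p^e$, and replace $\Omega$ inside $K^e$ by the half-space $H^e=\{x:(x-x_p^e)\cdot n_p^e\le 0\}$. Then, with $V_{\mathrm{exact}}=|\Omega|$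 and $V_h=\sum_{e=1}^m|K^e\cap H^e|$ (Lebesgue measure), $$|V_{\mathrm{exact}}-V_h|\le C h^2 .$$ -/

import Mathlib

open MeasureTheory Metric Topology

noncomputable section

namespace VolumeInsertion

/-- `φ` is a `C²` local defining function of `Ω` near the point `p`: it is twice continuously
differentiable near `p`, vanishes at `p` with nonzero gradient, and near `p` the set `Ω` is
exactly `{φ < 0}`. -/
structure IsLocalDefiningFunction {d : ℕ} (Ω : Set (EuclideanSpace ℝ (Fin d)))
    (p : EuclideanSpace ℝ (Fin d)) (φ : EuclideanSpace ℝ (Fin d) → ℝ) : Prop where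
  contDiffAt : ContDiffAt ℝ 2 φ p
  eq_zero : φ p = 0
  gradient_ne_zero : gradient φ p ≠ 0
  eventually_mem_iff : ∀ᶠ x in 𝓝 p, (x ∈ Ω ↔ φ x < 0)

/-- The boundary of `Ω` is of class `C²`, with `Ω` lying locally on one side of it. -/
def HasC2Boundary {d : ℕ} (Ω : Set (EuclideanSpace ℝ (Fin d))) : Prop :=
  ∀ p ∈ frontier Ω, ∃ φ, IsLocalDefiningFunction Ω p φ

/-- `n` is the outward unit normal of `Ω` at the boundary point `p`, that is, the normalized
gradient at `p` of a local defining function (it does not depend on which one). -/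
def IsOutwardUnitNormal {d : ℕ} (Ω : Set (EuclideanSpace ℝ (Fin d)))
    (p n : EuclideanSpace ℝ (Fin d)) : Prop :=
  ∃ φ, IsLocalDefiningFunction Ω p φ ∧ n = ‖gradient φ p‖⁻¹ • gradient φ p

/-- `p` is a point of the boundary of `Ω` that is closest to `c`. -/
def IsClosestBoundaryPoint {d : ℕ} (Ω : Set (EuclideanSpace ℝ (Fin d)))
    (c p : EuclideanSpace ℝ (Fin d)) : Prop :=
  p ∈ frontier Ω ∧ ∀ y ∈ frontier Ω, dist c p ≤ dist c y

/-- A finite mesh in `ℝᵈ`: measurable elements that overlap at most in null sets, each with a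
centroid. All that is recorded of a centroid is that it lies in the convex hull of its element;
this holds for the mean of the vertices and for the center of mass. -/
structure Mesh (d : ℕ) where
  numElements : ℕ
  element : Fin numElements → Set (EuclideanSpace ℝ (Fin d))
  centroid : Fin numElements → EuclideanSpace ℝ (Fin d)
  measurableSet_element : ∀ e, MeasurableSet (element e)
  aedisjoint : Pairwise fun e e' => AEDisjoint volume (element e) (element e')
  centroid_mem : ∀ e, centroid e ∈ convexHull ℝ (element e)

/-- The elements of the mesh cover `Ω` up to a null set. -/
def Mesh.Covers {d : ℕ} (T : Mesh d) (Ω : Set (EuclideanSpace ℝ (Fin d))) : Prop :=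
  volume (Ω \ ⋃ e, T.element e) = 0

/-- The mesh resolves the boundary of `Ω` at size `h`: each element has diameter at most `h`,
except that elements whose bounding sphere about the centroid does not reach the boundary may be
of any size (adaptive subdivision stops there). -/
def Mesh.Resolves {d : ℕ} (T : Mesh d) (Ω : Set (EuclideanSpace ℝ (Fin d))) (h : ℝ) : Prop :=
  ∀ e, (Bornology.IsBounded (T.element e) ∧ diam (T.element e) ≤ h) ∨
    T.element e ⊆ ball (T.centroid e) (infDist (T.centroid e) (frontier Ω))

/-- The closed half-space through `p` with outward normal `n`: the set where the local linear
approximation `x ↦ (x - p) · n` of the signed distance is nonpositive. -/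
def halfSpace {d : ℕ} (p n : EuclideanSpace ℝ (Fin d)) : Set (EuclideanSpace ℝ (Fin d)) :=
  {x | inner ℝ (x - p) n ≤ 0}

/-- The inserted volume `V_h`: in every element `e` the geometry is replaced by the half-space
through `p e` with outward normal `n e`. -/
def Mesh.insertedVolume {d : ℕ} (T : Mesh d)
    (p n : Fin T.numElements → EuclideanSpace ℝ (Fin d)) : ℝ :=
  ∑ e, volume.real (T.element e ∩ halfSpace (p e) (n e))

end VolumeInsertion

end

open Set

/-! In each element the error is at most the volume of the points where `Ω` and the half-space
disagree. The open ball about the centroid reaching to its closest boundary point misses the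
boundary, so it lies in `Ω` or in the complement, and the normal is plus or minus its radial
direction; hence the two sets agree there (`mem_iff_mem_halfSpace_of_mem_ball`). Disagreements
therefore lie within `2h` of the base point, and elements inside their ball have none. At such
points Taylor's formula makes a local defining function `O(h²)`. A layer `|φ| ≤ ε` has volume
`O(ε)`, because `φ` grows at a definite rate along its gradient (`exists_measure_abs_le_bound`).
Compactness of the boundary yields one set `S` of volume `O(h²)` containing all disagreements
(`HasC2Boundary.exists_error_set`). Since elements overlap only in null sets, the errors sum to at
most `|S|`, however many elements there are. -/

namespace VolumeInsertion

/-! ### Directions, gradients and rays -/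

section InnerProduct

variable {E : Type*} [NormedAddCommGroup E] [InnerProductSpace ℝ E]

/-- If the open half-space `{v | ⟪u, v⟫ < 0}` is contained in `{v | ⟪a, v⟫ ≤ 0}`, then `u` and `a`
have the same direction. -/
theorem normalize_eq_of_halfSpace_subset {u a : E} (hu : u ≠ 0) (ha : a ≠ 0)
    (h : ∀ v, inner ℝ u v < 0 → inner ℝ a v ≤ 0) : ‖a‖⁻¹ • a = ‖u‖⁻¹ • u := by
  have hu' : 0 < ‖u‖ := norm_pos_iff.2 hu
  have ha' : 0 < ‖a‖ := norm_pos_iff.2 ha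
  -- Pass to the closed half-space: `v - s • u` lies in the open one for `s > 0`; let `s → 0`.
  have hle : ∀ v, inner ℝ u v ≤ 0 → inner ℝ a v ≤ 0 := by
    intro v hv
    have hlim : Filter.Tendsto (fun s : ℝ => inner ℝ a v - s * inner ℝ a u) (𝓝[>] 0)
        (𝓝 (inner ℝ a v - 0 * inner ℝ a u)) := by
      apply Filter.Tendsto.mono_left _ nhdsWithin_le_nhds
      exact Continuous.tendsto (by fun_prop) 0
    rw [zero_mul, sub_zero] at hlim
    refine le_of_tendsto hlim ?_
    filter_upwards [self_mem_nhdsWithin] with s hs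
    have hs : 0 < s := hs
    have := h (v - s • u) (by
      rw [inner_sub_right, inner_smul_right, real_inner_self_eq_norm_sq]
      have : 0 < s * ‖u‖ ^ 2 := by positivity
      linarith)
    rwa [inner_sub_right, inner_smul_right] at this
  have hnonneg : 0 ≤ inner ℝ u a := by
    have := hle (-u) (by
      rw [inner_neg_right, real_inner_self_eq_norm_sq]
      have : 0 < ‖u‖ ^ 2 := by positivity
      linarith)
    rw [inner_neg_right, real_inner_comm] at this
    linarith
  have hsq : ‖u‖ ^ 2 * ‖a‖ ^ 2 ≤ inner ℝ u a ^ 2 := by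
    -- The test vector is a multiple of the component of `a` orthogonal to `u`; it gives the reverse
    -- Cauchy–Schwarz inequality.
    have := hle (‖u‖ ^ 2 • a - inner ℝ u a • u) (by
      rw [inner_sub_right, inner_smul_right, inner_smul_right, real_inner_self_eq_norm_sq]
      linarith)
    rw [inner_sub_right, inner_smul_right, inner_smul_right, real_inner_self_eq_norm_sq,
      real_inner_comm u a] at this
    linarith [sq (inner ℝ u a)]
  have heq : inner ℝ u a = ‖u‖ * ‖a‖ := by
    refine le_antisymm (real_inner_le_norm u a) ?_
    rw [← mul_pow] at hsq
    exact le_of_sq_le_sq hsq hnonneg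
  have := (inner_eq_norm_mul_iff_real (x := u) (y := a)).1 heq
  rw [inv_smul_eq_iff₀ ha'.ne', smul_comm, eq_inv_smul_iff₀ hu'.ne', this]

/-- A differentiable function that is nonpositive along a ray from a zero has a nonpositive
directional derivative there. -/
theorem inner_gradient_nonpos [CompleteSpace E] {φ : E → ℝ} {p v : E}
    (hφ : DifferentiableAt ℝ φ p) (hp : φ p = 0)
    (h : ∀ᶠ t : ℝ in 𝓝[>] 0, φ (p + t • v) ≤ 0) : inner ℝ (gradient φ p) v ≤ 0 := by
  have hd := hφ.hasFDerivAt.hasLineDerivAt v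
  have hlim := hd.tendsto_slope_zero_right
  rw [show inner ℝ (gradient φ p) v = fderiv ℝ φ p v by simp [gradient]]
  refine le_of_tendsto hlim ?_
  filter_upwards [h, self_mem_nhdsWithin] with t ht ht0
  have ht0 : 0 < t := ht0
  simp only [hp, sub_zero, smul_eq_mul]
  exact mul_nonpos_of_nonneg_of_nonpos (by positivity) ht

theorem eventually_neg_of_inner_gradient_neg [CompleteSpace E] {φ : E → ℝ} {p v : E}
    (hφ : DifferentiableAt ℝ φ p) (hp : φ p = 0) (h : inner ℝ (gradient φ p) v < 0) :
    ∀ᶠ t : ℝ in 𝓝[>] 0, φ (p + t • v) < 0 := by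
  have hd := hφ.hasFDerivAt.hasLineDerivAt v
  have hlim := hd.tendsto_slope_zero_right
  rw [show inner ℝ (gradient φ p) v = fderiv ℝ φ p v by simp [gradient]] at h
  filter_upwards [hlim.eventually_lt_const h, self_mem_nhdsWithin] with t ht ht0
  have ht0 : 0 < t := ht0
  simp only [hp, sub_zero, smul_eq_mul] at ht
  by_contra! hc
  have : 0 ≤ t⁻¹ * φ (p + t • v) := by positivity
  linarith

theorem tendsto_add_smul_nhdsGT (p v : E) :
    Filter.Tendsto (fun t : ℝ => p + t • v) (𝓝[>] 0) (𝓝 p) := by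
  apply Filter.Tendsto.mono_left _ nhdsWithin_le_nhds
  exact Continuous.tendsto' (by fun_prop) _ _ (by simp)

/-- A ray from a point of a sphere pointing inwards starts inside the ball. -/
theorem eventually_add_smul_mem_ball {c p v : E} (h : inner ℝ (p - c) v < 0) :
    ∀ᶠ t : ℝ in 𝓝[>] 0, p + t • v ∈ ball c (dist c p) := by
  have hlim : Filter.Tendsto (fun t : ℝ => 2 * inner ℝ (p - c) v + t * ‖v‖ ^ 2) (𝓝[>] 0)
      (𝓝 (2 * inner ℝ (p - c) v)) := by
    apply Filter.Tendsto.mono_left _ nhdsWithin_le_nhds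
    exact Continuous.tendsto' (by fun_prop) _ _ (by simp)
  filter_upwards [hlim.eventually_lt_const (by linarith : 2 * inner ℝ (p - c) v < 0),
    self_mem_nhdsWithin] with t ht ht0
  have ht0 : 0 < t := ht0
  rw [mem_ball, dist_comm c p, dist_eq_norm, dist_eq_norm]
  refine lt_of_pow_lt_pow_left₀ 2 (norm_nonneg _) ?_
  rw [show p + t • v - c = (p - c) + t • v by abel, norm_add_sq_real, inner_smul_right, norm_smul,
    Real.norm_eq_abs, abs_of_pos ht0]
  nlinarith [mul_neg_of_pos_of_neg ht0 ht]

end InnerProduct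

/-! ### Volume bound by packing translates -/

/-- If a set `A` in a ball of radius `r` is disjoint from its translates by at least `t` in the
direction of a unit vector `v`, then its measure is at most `t / r` times that of the ball of
twice the radius. -/
theorem measure_le_of_translates_disjoint {E : Type*} [NormedAddCommGroup E] [NormedSpace ℝ E]
    [MeasurableSpace E] [BorelSpace E] (μ : Measure E) [μ.IsAddLeftInvariant]
    {A : Set E} {p v : E} {r t : ℝ} (hA : MeasurableSet A) (hAr : A ⊆ closedBall p r)
    (hv : ‖v‖ = 1) (hr : 0 < r) (ht : 0 < t)
    (h : ∀ x ∈ A, ∀ s, t ≤ s → s • v + x ∉ A) :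
    μ A ≤ ENNReal.ofReal (t / r) * μ (closedBall p (2 * r)) := by
  -- `N ≥ r / t`, while the largest shift `(N - 1) * t` is still at most `r`, so all translates stay
  -- in the doubled ball.
  set N : ℕ := ⌊r / t⌋₊ + 1
  let B : Fin N → Set E := fun k => (fun x => -((k : ℝ) * t) • v + x) ⁻¹' A
  have hBm : ∀ k, MeasurableSet (B k) := fun k => measurable_const_add _ hA
  have hBμ : ∀ k, μ (B k) = μ A := fun k => measure_preimage_add μ _ A
  have hlt : ∀ i j : Fin N, i < j → Disjoint (B i) (B j) := by
    intro i j hij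
    rw [Set.disjoint_left]
    intro x hi hj
    refine h _ hj (((j : ℝ) - i) * t) ?_ ?_
    · have : (i : ℝ) + 1 ≤ j := by exact_mod_cast hij
      nlinarith
    · have hi' : -((i : ℝ) * t) • v + x ∈ A := hi
      convert hi' using 1
      rw [← add_assoc, ← add_smul]
      congr 2
      ring
  have hBd : Pairwise (Function.onFun Disjoint B) := by
    intro i j hij
    rcases lt_or_gt_of_ne hij with h' | h'
    · exact hlt i j h'
    · exact (hlt j i h').symm
  have hBs : (⋃ k, B k) ⊆ closedBall p (2 * r) := by
    refine iUnion_subset fun k x hx => ?_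
    have h1 : dist (-((k : ℝ) * t) • v + x) p ≤ r := hAr hx
    have h2 : dist x (-((k : ℝ) * t) • v + x) ≤ r := by
      rw [dist_eq_norm, show x - (-((k : ℝ) * t) • v + x) = ((k : ℝ) * t) • v by
        rw [neg_smul]; abel, norm_smul, hv, mul_one, Real.norm_of_nonneg (by positivity)]
      have hk : (k : ℝ) ≤ r / t := by
        refine le_trans ?_ (Nat.floor_le (by positivity))
        exact_mod_cast Nat.lt_succ_iff.1 k.2
      exact (le_div_iff₀ ht).1 hk
    rw [mem_closedBall]
    linarith [dist_triangle x (-((k : ℝ) * t) • v + x) p]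
  have hsum : (N : ENNReal) * μ A ≤ μ (closedBall p (2 * r)) := by
    calc (N : ENNReal) * μ A = ∑ k, μ (B k) := by simp [hBμ]
      _ = μ (⋃ k, B k) := by rw [measure_iUnion hBd hBm, tsum_fintype]
      _ ≤ _ := measure_mono hBs
  have hN : 1 ≤ ENNReal.ofReal (t / r) * (N : ENNReal) := by
    rw [← ENNReal.ofReal_natCast, ← ENNReal.ofReal_mul (by positivity), ENNReal.one_le_ofReal]
    have : r / t ≤ N := by
      simp only [N]; push_cast; exact (Nat.lt_floor_add_one _).le
    calc (1 : ℝ) = t / r * (r / t) := by field_simp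
      _ ≤ _ := by gcongr
  calc μ A = 1 * μ A := (one_mul _).symm
    _ ≤ ENNReal.ofReal (t / r) * N * μ A := by gcongr
    _ = ENNReal.ofReal (t / r) * (N * μ A) := mul_assoc _ _ _
    _ ≤ _ := by gcongr

/-! ### Outward normals and the ball touching the boundary -/

variable {d : ℕ} {Ω : Set (EuclideanSpace ℝ (Fin d))}

/-- The outward unit normal can be computed with any local defining function near the point. -/
theorem IsOutwardUnitNormal.eq_normalize_gradient {p n : EuclideanSpace ℝ (Fin d)}
    (hn : IsOutwardUnitNormal Ω p n) {ψ : EuclideanSpace ℝ (Fin d) → ℝ}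
    (hψ : IsLocalDefiningFunction Ω p ψ) : n = ‖gradient ψ p‖⁻¹ • gradient ψ p := by
  obtain ⟨φ, hφ, rfl⟩ := hn
  -- A ray along which `ψ` decreases starts inside `Ω`, so `φ` is negative on it too.
  refine normalize_eq_of_halfSpace_subset hψ.gradient_ne_zero hφ.gradient_ne_zero fun v hv => ?_
  refine inner_gradient_nonpos (hφ.contDiffAt.differentiableAt (by norm_num)) hφ.eq_zero ?_
  have hlim := tendsto_add_smul_nhdsGT p v
  filter_upwards [eventually_neg_of_inner_gradient_neg
    (hψ.contDiffAt.differentiableAt (by norm_num)) hψ.eq_zero hv,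
    hlim.eventually hφ.eventually_mem_iff, hlim.eventually hψ.eventually_mem_iff] with t h1 h2 h3
  exact (h2.1 (h3.2 h1)).le

theorem IsOutwardUnitNormal.norm_eq_one {p n : EuclideanSpace ℝ (Fin d)}
    (hn : IsOutwardUnitNormal Ω p n) : ‖n‖ = 1 := by
  obtain ⟨φ, hφ, rfl⟩ := hn
  rw [norm_smul, norm_inv, norm_norm, inv_mul_cancel₀ (norm_ne_zero_iff.2 hφ.gradient_ne_zero)]

/-- If a ball centered at `c` does not reach beyond the closest boundary point `p` of `c`, then
`Ω` and the tangent half-space at `p` agree on it. -/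
theorem mem_iff_mem_halfSpace_of_mem_ball (hΩ : IsOpen Ω) {c p n x : EuclideanSpace ℝ (Fin d)}
    (hp : IsClosestBoundaryPoint Ω c p) (hn : IsOutwardUnitNormal Ω p n)
    (hx : x ∈ ball c (dist c p)) : x ∈ Ω ↔ x ∈ halfSpace p n := by
  have hn1 := hn.norm_eq_one
  have hR : 0 < dist c p := pos_of_mem_ball hx
  have hpc : p - c ≠ 0 := by
    rw [sub_ne_zero]; rintro rfl; simp at hR
  have hdisj : Disjoint (ball c (dist c p)) (frontier Ω) := by
    rw [Set.disjoint_left]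
    intro y hy hyf
    rw [mem_ball, dist_comm] at hy
    exact absurd (hp.2 y hyf) (not_le.2 hy)
  have hconn : IsPreconnected (ball c (dist c p)) := (convex_ball _ _).isPreconnected
  have hxc : |inner ℝ (x - c) n| < dist c p := by
    refine (abs_real_inner_le_norm _ _).trans_lt ?_
    rw [hn1, mul_one, ← dist_eq_norm]
    exact hx
  rw [abs_lt] at hxc
  have hsplit : inner ℝ (x - p) n = inner ℝ (x - c) n - inner ℝ (p - c) n := by
    rw [← inner_sub_left]; congr 1; abel
  have hnorm : inner ℝ (p - c) (‖p - c‖⁻¹ • (p - c)) = dist c p := by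
    rw [inner_smul_right, real_inner_self_eq_norm_sq, dist_comm, dist_eq_norm]
    have := norm_ne_zero_iff.2 hpc
    field_simp
  have hdich : ball c (dist c p) ⊆ Ω ∨ ball c (dist c p) ⊆ Ωᶜ := by
    have hsub : ball c (dist c p) ⊆ Ω ∪ (closure Ω)ᶜ := by
      intro y hy
      by_contra hcon
      rw [mem_union, not_or, mem_compl_iff, not_not] at hcon
      refine Set.disjoint_left.1 hdisj hy ?_
      rw [hΩ.frontier_eq]
      exact ⟨hcon.2, hcon.1⟩
    exact (hconn.subset_or_subset hΩ isClosed_closure.isOpen_compl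
      (disjoint_compl_right_iff_subset.2 subset_closure) hsub).imp_right
      fun h => h.trans (compl_subset_compl.2 subset_closure)
  obtain ⟨φ, hφ, rfl⟩ := hn
  have hdiff := hφ.contDiffAt.differentiableAt (by norm_num)
  simp only [halfSpace, mem_ofPred_eq, hsplit]
  rcases hdich with hin | hout
  · have hdir := normalize_eq_of_halfSpace_subset hpc hφ.gradient_ne_zero fun v hv => by
      refine inner_gradient_nonpos hdiff hφ.eq_zero ?_
      filter_upwards [eventually_add_smul_mem_ball hv,
        (tendsto_add_smul_nhdsGT p v).eventually hφ.eventually_mem_iff] with t h1 h2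
      exact (h2.1 (hin h1)).le
    rw [hdir] at hxc ⊢
    rw [hnorm]
    exact iff_of_true (hin hx) (by linarith)
  -- Exterior centroid: rays into the ball leave `Ω`, so `φ` cannot decrease along them and the
  -- normal points from `p` to `c`.
  · have hdir := normalize_eq_of_halfSpace_subset (u := p - c) (a := -gradient φ p) hpc
        (neg_ne_zero.2 hφ.gradient_ne_zero) fun v hv => by
      rw [inner_neg_left, neg_nonpos]
      by_contra! hneg
      obtain ⟨t, h1, h2, h3⟩ := ((eventually_add_smul_mem_ball hv).and
        ((eventually_neg_of_inner_gradient_neg hdiff hφ.eq_zero hneg).and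
        ((tendsto_add_smul_nhdsGT p v).eventually hφ.eventually_mem_iff))).exists
      exact hout h1 (h3.2 h2)
    rw [norm_neg, smul_neg, neg_eq_iff_eq_neg] at hdir
    rw [hdir, inner_neg_right] at hxc ⊢
    rw [inner_neg_right, hnorm]
    exact iff_of_false (hout hx) (by linarith)

/-- Openness of `Ω` forces `φ` to vanish at nearby boundary points: a positive value would keep `p`
out of the closure, a negative one would put `p` in `Ω`. One `φ`, with uniform constants, thus
serves all nearby base points. -/
theorem IsLocalDefiningFunction.eventually (hΩ : IsOpen Ω) {q : EuclideanSpace ℝ (Fin d)}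
    {φ : EuclideanSpace ℝ (Fin d) → ℝ} (hφ : IsLocalDefiningFunction Ω q φ) :
    ∀ᶠ p in 𝓝 q, p ∈ frontier Ω → IsLocalDefiningFunction Ω p φ := by
  have hgrad : ContinuousAt (gradient φ) q := by
    have h1 : ContDiffAt ℝ 1 (fderiv ℝ φ) q := hφ.contDiffAt.fderiv_right (by norm_num)
    exact (LinearIsometryEquiv.continuous _).continuousAt.comp h1.continuousAt
  filter_upwards [hφ.contDiffAt.eventually (by simp), hφ.eventually_mem_iff.eventually_nhds,
    hgrad.eventually_ne hφ.gradient_ne_zero] with p h1 h2 h3 hp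
  refine ⟨h1, le_antisymm ?_ ?_, h3, h2⟩
  · by_contra! hpos
    have hcl : ∃ᶠ y in 𝓝 p, y ∈ Ω := mem_closure_iff_frequently.1 (frontier_subset_closure hp)
    obtain ⟨y, hy, hy1, hy2⟩ := (hcl.and_eventually
      (h2.and (h1.continuousAt.eventually (lt_mem_nhds hpos)))).exists
    exact absurd (hy1.1 hy) (not_lt.2 hy2.le)
  · by_contra! hneg
    rw [hΩ.frontier_eq] at hp
    exact hp.2 (h2.self_of_nhds.2 hneg)

/-! ### Taylor remainder and thin level layers -/

/-- Second order Taylor estimate with a uniform constant near a point. -/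
theorem exists_taylor_bound {E : Type*} [NormedAddCommGroup E] [NormedSpace ℝ E]
    {φ : E → ℝ} {q : E} (hφ : ContDiffAt ℝ 2 φ q) :
    ∃ M : ℝ, 0 ≤ M ∧ ∃ r > 0, ∀ x ∈ ball q r, ∀ y ∈ ball q r,
      |φ x - φ y - fderiv ℝ φ y (x - y)| ≤ M * ‖x - y‖ ^ 2 := by
  have h1 : ContDiffAt ℝ 1 (fderiv ℝ φ) q := hφ.fderiv_right (by norm_num)
  obtain ⟨K, s, hs, hK⟩ := h1.exists_lipschitzOnWith
  obtain ⟨r, hr, hball⟩ := Metric.eventually_nhds_iff_ball.1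
    ((hφ.eventually (by simp)).and hs)
  refine ⟨K, K.2, r, hr, fun x hx y hy => ?_⟩
  -- On this intersection the Lipschitz derivative varies from its value at `y` by at most `K * ‖x -
  -- y‖`.
  have hconv : Convex ℝ (ball q r ∩ closedBall y ‖x - y‖) :=
    (convex_ball _ _).inter (convex_closedBall _ _)
  have := hconv.norm_image_sub_le_of_norm_hasFDerivWithin_le' (f := φ) (f' := fderiv ℝ φ)
    (φ := fderiv ℝ φ y) (C := K * ‖x - y‖) (x := y) (y := x)
    (fun z hz => ((hball z hz.1).1.differentiableAt (by norm_num)).hasFDerivAt.hasFDerivWithinAt)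
    (fun z hz => (hK.norm_sub_le (hball z hz.1).2 (hball y hy).2).trans (by
      have := hz.2
      rw [mem_closedBall, dist_eq_norm] at this
      gcongr)) ⟨hy, by simp⟩ ⟨hx, by simp [dist_eq_norm]⟩
  rw [Real.norm_eq_abs] at this
  rw [sq, ← mul_assoc]
  exact this

/-- The measure of a thickened level set `{|φ| ≤ ε}` near a regular point is `O(ε)`. -/
theorem exists_measure_abs_le_bound {E : Type*} [NormedAddCommGroup E] [InnerProductSpace ℝ E]
    [FiniteDimensional ℝ E] [MeasurableSpace E] [BorelSpace E] (μ : Measure E) [μ.IsAddHaarMeasure]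
    {φ : E → ℝ} {q : E} (hφ : ContDiffAt ℝ 1 φ q) (hgrad : gradient φ q ≠ 0) :
    ∃ A : ℝ, 0 ≤ A ∧ ∃ r > 0, ∀ ε > 0,
      MeasurableSet (closedBall q r ∩ {x | |φ x| ≤ ε}) ∧
      μ (closedBall q r ∩ {x | |φ x| ≤ ε}) ≤ ENNReal.ofReal (A * ε) := by
  set a := gradient φ q
  have ha : 0 < ‖a‖ := norm_pos_iff.2 hgrad
  have hfd : ∀ y, fderiv ℝ φ q y = inner ℝ a y := fun y => by simp [a, gradient]
  have hstrict : HasStrictFDerivAt φ (fderiv ℝ φ q) q := hφ.hasStrictFDerivAt one_ne_zero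
  have hev := hstrict.isLittleO.def (half_pos ha)
  obtain ⟨R, hR, hball⟩ := Metric.eventually_nhds_iff_ball.1 hev
  obtain ⟨R', hR', hball'⟩ := Metric.eventually_nhds_iff_ball.1 (hφ.eventually (by simp))
  set r := min R R' / 2
  have hr : 0 < r := by positivity
  have hrR : closedBall q r ⊆ ball q R := closedBall_subset_ball (by
    have := min_le_left R R'
    simp only [r]; linarith)
  have hrR' : closedBall q r ⊆ ball q R' := closedBall_subset_ball (by
    have := min_le_right R R'
    simp only [r]; linarith)
  have hcont : ContinuousOn φ (closedBall q r) := fun x hx =>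
    (hball' x (hrR' hx)).continuousAt.continuousWithinAt
  refine ⟨5 / ‖a‖ / r * μ.real (closedBall q (2 * r)), by positivity, r, hr, fun ε hε => ?_⟩
  have hmeas : MeasurableSet (closedBall q r ∩ {x | |φ x| ≤ ε}) :=
    (hcont.abs.preimage_isClosed_of_isClosed isClosed_closedBall isClosed_Iic).measurableSet
  refine ⟨hmeas, ?_⟩
  have hunit : ‖‖a‖⁻¹ • a‖ = 1 := norm_smul_inv_norm (𝕜 := ℝ) hgrad
  have hfin : μ (closedBall q (2 * r)) ≠ ⊤ := measure_closedBall_lt_top.ne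
  -- `φ` grows at rate at least `‖a‖ / 2` along `a`, so a shift by `5 / ‖a‖ * ε` raises it by at
  -- least `5ε/2`, more than the width `2ε` of the layer.
  refine (measure_le_of_translates_disjoint μ hmeas inter_subset_left (v := ‖a‖⁻¹ • a)
    (t := 5 / ‖a‖ * ε) hunit hr (by positivity) ?_).trans_eq ?_
  · rintro x ⟨hx, hxε⟩ s hs ⟨hy, hyε⟩
    have hs0 : 0 < s := lt_of_lt_of_le (by positivity) hs
    have h := hball (s • ‖a‖⁻¹ • a + x, x) (by
      rw [← ball_prod_same]
      exact ⟨hrR hy, hrR hx⟩)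
    have hnorm : ‖s • ‖a‖⁻¹ • a‖ = s := by
      rw [norm_smul, hunit, Real.norm_of_nonneg hs0.le, mul_one]
    have hinner : inner ℝ a (s • ‖a‖⁻¹ • a) = s * ‖a‖ := by
      rw [inner_smul_right, inner_smul_right, real_inner_self_eq_norm_sq]
      field_simp
    simp only [add_sub_cancel_right, hfd, hnorm, hinner, Real.norm_eq_abs] at h
    have hxε : |φ x| ≤ ε := hxε
    have hyε : |φ (s • ‖a‖⁻¹ • a + x)| ≤ ε := hyε
    rw [abs_le] at h hxε hyε
    have hsa : 5 * ε ≤ s * ‖a‖ := by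
      rw [div_mul_eq_mul_div, div_le_iff₀ ha] at hs
      exact hs
    linarith [h.1, hxε.1, hyε.2]
  · rw [← ENNReal.ofReal_toReal hfin, ← ENNReal.ofReal_mul (by positivity)]
    congr 1
    simp only [Measure.real]
    ring

/-! ### Error sets of volume `O(h²)` -/

/-- Near a boundary point, the set where `Ω` differs from its tangent half-spaces at distance at
most `2 h` from their base points is contained in a set of measure `O(h²)`. -/
theorem IsLocalDefiningFunction.exists_error_set (hΩ : IsOpen Ω) {q : EuclideanSpace ℝ (Fin d)}
    {φ : EuclideanSpace ℝ (Fin d) → ℝ} (hφ : IsLocalDefiningFunction Ω q φ) :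
    ∃ s ∈ 𝓝 q, ∃ C δ : ℝ, 0 ≤ C ∧ 0 < δ ∧ ∀ h, 0 < h → h ≤ δ →
      ∃ S : Set (EuclideanSpace ℝ (Fin d)), MeasurableSet S ∧
        volume S ≤ ENNReal.ofReal (C * h ^ 2) ∧
        ∀ p ∈ s, p ∈ frontier Ω → ∀ n, IsOutwardUnitNormal Ω p n →
          ∀ x ∈ closedBall p (2 * h), ¬(x ∈ Ω ↔ x ∈ halfSpace p n) → x ∈ S := by
  obtain ⟨A, hA, r₁, hr₁, hvol⟩ := exists_measure_abs_le_bound volume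
    (hφ.contDiffAt.of_le (by norm_num)) hφ.gradient_ne_zero
  obtain ⟨M, hM, r₂, hr₂, htaylor⟩ := exists_taylor_bound hφ.contDiffAt
  obtain ⟨r₃, hr₃, hloc⟩ := Metric.eventually_nhds_iff_ball.1
    ((hφ.eventually hΩ).and hφ.eventually_mem_iff)
  set r := min r₁ (min r₂ r₃)
  have hr : 0 < r := by positivity
  have hrr₁ : r ≤ r₁ := min_le_left _ _
  have hrr₂ : r ≤ r₂ := (min_le_right _ _).trans (min_le_left _ _)
  have hrr₃ : r ≤ r₃ := (min_le_right _ _).trans (min_le_right _ _)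
  -- `4 * M` comes from `‖x - p‖ ≤ 2 * h`; the `+ 1` keeps the layer width positive. With `h ≤ r /
  -- 4`, `x` stays within `r` of `q`.
  refine ⟨ball q (r / 2), ball_mem_nhds _ (by positivity), A * (4 * M + 1), r / 4, by positivity,
    by positivity, fun h h0 hh => ?_⟩
  obtain ⟨hmeas, hle⟩ := hvol ((4 * M + 1) * h ^ 2) (by positivity)
  refine ⟨_, hmeas, hle.trans_eq (by rw [mul_assoc]), fun p hp hpf n hn x hx hxne => ?_⟩
  have hxq : x ∈ ball q r := by
    rw [mem_ball, mem_closedBall] at *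
    linarith [dist_triangle x p q]
  have hpq : p ∈ ball q r := ball_subset_ball (by linarith) hp
  refine ⟨ball_subset_closedBall (ball_subset_ball hrr₁ hxq), ?_⟩
  have hφp := (hloc p (ball_subset_ball hrr₃ hpq)).1 hpf
  have hxΩ := (hloc x (ball_subset_ball hrr₃ hxq)).2
  have ht := htaylor x (ball_subset_ball hrr₂ hxq) p (ball_subset_ball hrr₂ hpq)
  have hg : 0 < ‖gradient φ p‖ := norm_pos_iff.2 hφp.gradient_ne_zero
  have hfd : fderiv ℝ φ p (x - p) = ‖gradient φ p‖ * inner ℝ (x - p) n := by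
    rw [hn.eq_normalize_gradient hφp, inner_smul_right, mul_inv_cancel_left₀ hg.ne',
      real_inner_comm]
    simp [gradient]
  have hsq : M * ‖x - p‖ ^ 2 ≤ (4 * M + 1) * h ^ 2 := by
    have h1 : ‖x - p‖ ≤ 2 * h := by rw [← dist_eq_norm]; exact hx
    have h2 : ‖x - p‖ ^ 2 ≤ (2 * h) ^ 2 := by gcongr
    nlinarith [mul_le_mul_of_nonneg_left h2 hM]
  rw [hφp.eq_zero, sub_zero, hfd, abs_le] at ht
  change |φ x| ≤ _
  rw [hxΩ, halfSpace, mem_ofPred_eq] at hxne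
  rw [abs_le]
  -- At a disagreement `φ x` and its linear part do not share a strict sign, so `|φ x|` is at most
  -- the Taylor remainder.
  rcases lt_or_ge (φ x) 0 with hneg | hnonneg
  · have hpos : 0 < inner ℝ (x - p) n := by
      by_contra! hcon
      exact hxne (iff_of_true hneg hcon)
    constructor <;> nlinarith [mul_pos hg hpos]
  · have hnp : inner ℝ (x - p) n ≤ 0 := by
      by_contra! hcon
      exact hxne (iff_of_false (not_lt.2 hnonneg) (not_le.2 hcon))
    constructor <;> nlinarith [mul_nonneg hg.le (neg_nonneg.2 hnp)]

/-- The local error sets can be chosen uniformly along the compact boundary. -/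
theorem HasC2Boundary.exists_error_set (hC2 : HasC2Boundary Ω) (hΩ : IsOpen Ω)
    (hb : Bornology.IsBounded Ω) :
    ∃ C δ : ℝ, 0 ≤ C ∧ 0 < δ ∧ ∀ h, 0 < h → h ≤ δ →
      ∃ S : Set (EuclideanSpace ℝ (Fin d)), MeasurableSet S ∧
        volume S ≤ ENNReal.ofReal (C * h ^ 2) ∧
        ∀ p ∈ frontier Ω, ∀ n, IsOutwardUnitNormal Ω p n →
          ∀ x ∈ closedBall p (2 * h), ¬(x ∈ Ω ↔ x ∈ halfSpace p n) → x ∈ S := by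
  have hcomp : IsCompact (frontier Ω) :=
    hb.isCompact_closure.of_isClosed_subset isClosed_frontier frontier_subset_closure
  -- Over finite unions the error sets unite, the constants add and the thresholds take their
  -- minimum.
  have hunif := hcomp.induction_on (p := fun s => ∃ C δ : ℝ, 0 ≤ C ∧ 0 < δ ∧ ∀ h, 0 < h → h ≤ δ →
      ∃ S : Set (EuclideanSpace ℝ (Fin d)), MeasurableSet S ∧
        volume S ≤ ENNReal.ofReal (C * h ^ 2) ∧
        ∀ p ∈ s, p ∈ frontier Ω → ∀ n, IsOutwardUnitNormal Ω p n →
          ∀ x ∈ closedBall p (2 * h), ¬(x ∈ Ω ↔ x ∈ halfSpace p n) → x ∈ S) ?_ ?_ ?_ ?_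
  · obtain ⟨C, δ, hC, hδ, H⟩ := hunif
    refine ⟨C, δ, hC, hδ, fun h h0 hh => ?_⟩
    obtain ⟨S, hS, hv, hx⟩ := H h h0 hh
    exact ⟨S, hS, hv, fun p hp => hx p hp hp⟩
  · exact ⟨0, 1, le_rfl, one_pos, fun h _ _ => ⟨∅, MeasurableSet.empty, by simp, by simp⟩⟩
  · rintro s t hst ⟨C, δ, hC, hδ, H⟩
    refine ⟨C, δ, hC, hδ, fun h h0 hh => ?_⟩
    obtain ⟨S, hS, hv, hx⟩ := H h h0 hh
    exact ⟨S, hS, hv, fun p hp => hx p (hst hp)⟩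
  · rintro s t ⟨C, δ, hC, hδ, H⟩ ⟨C', δ', hC', hδ', H'⟩
    refine ⟨C + C', min δ δ', by positivity, by positivity, fun h h0 hh => ?_⟩
    obtain ⟨S, hS, hv, hx⟩ := H h h0 (hh.trans (min_le_left _ _))
    obtain ⟨S', hS', hv', hx'⟩ := H' h h0 (hh.trans (min_le_right _ _))
    refine ⟨S ∪ S', hS.union hS', (measure_union_le _ _).trans ?_, ?_⟩
    · rw [add_mul, ENNReal.ofReal_add (by positivity) (by positivity)]
      exact add_le_add hv hv'
    · rintro p (hp | hp) hpf n hn x hxb hne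
      · exact Or.inl (hx p hp hpf n hn x hxb hne)
      · exact Or.inr (hx' p hp hpf n hn x hxb hne)
  · intro q hq
    obtain ⟨φ, hφ⟩ := hC2 q hq
    obtain ⟨s, hs, H⟩ := hφ.exists_error_set hΩ
    exact ⟨s, mem_nhdsWithin_of_mem_nhds hs, H⟩

/-! ### From elements to the whole mesh -/

/-- In an element of a resolving mesh, a point where `Ω` and the tangent half-space differ is at
distance at most `2 h` from the base point of the half-space. -/
theorem Mesh.Resolves.mem_closedBall (hΩ : IsOpen Ω) {T : Mesh d} {h : ℝ} (hT : T.Resolves Ω h)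
    {e : Fin T.numElements} {p n x : EuclideanSpace ℝ (Fin d)}
    (hp : IsClosestBoundaryPoint Ω (T.centroid e) p) (hn : IsOutwardUnitNormal Ω p n)
    (hx : x ∈ T.element e) (hne : ¬(x ∈ Ω ↔ x ∈ halfSpace p n)) : x ∈ closedBall p (2 * h) := by
  have hxball : dist (T.centroid e) p ≤ dist x (T.centroid e) := by
    by_contra! hcon
    exact hne (mem_iff_mem_halfSpace_of_mem_ball hΩ hp hn hcon)
  rcases hT e with ⟨hbdd, hdiam⟩ | hsub
  · have hxc : dist x (T.centroid e) ≤ h := by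
      refine le_trans ?_ hdiam
      rw [← convexHull_diam]
      exact dist_le_diam_of_mem (isBounded_convexHull.2 hbdd) (subset_convexHull ℝ _ hx)
        (T.centroid_mem e)
    rw [Metric.mem_closedBall]
    linarith [dist_triangle x (T.centroid e) p]
  -- Contradiction with `hxball`: such an element contains no disagreement.
  · have h1 : dist x (T.centroid e) < infDist (T.centroid e) (frontier Ω) := hsub hx
    linarith [infDist_le_dist_of_mem (x := T.centroid e) hp.1]

theorem Mesh.Resolves.isBounded_element {T : Mesh d} {h : ℝ} (hT : T.Resolves Ω h)
    (e : Fin T.numElements) : Bornology.IsBounded (T.element e) :=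
  (hT e).elim And.left isBounded_ball.subset

theorem Mesh.sum_volume_real_inter (T : Mesh d) {S : Set (EuclideanSpace ℝ (Fin d))}
    (hS : MeasurableSet S) (hfin : volume S ≠ ⊤) :
    ∑ e, volume.real (T.element e ∩ S) = volume.real (S ∩ ⋃ e, T.element e) := by
  rw [inter_comm S, iUnion_inter, measureReal_def, measure_iUnion₀
    (fun i j hij => (T.aedisjoint hij).mono inter_subset_left inter_subset_left)
    (fun e => ((T.measurableSet_element e).inter hS).nullMeasurableSet), tsum_fintype,
    ENNReal.toReal_sum fun e _ => measure_ne_top_of_subset inter_subset_right hfin]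
  rfl

theorem Mesh.Covers.sum_volume_real_inter {T : Mesh d} (hT : T.Covers Ω) (hΩ : MeasurableSet Ω)
    (hfin : volume Ω ≠ ⊤) : ∑ e, volume.real (T.element e ∩ Ω) = volume.real Ω := by
  rw [T.sum_volume_real_inter hΩ hfin]
  refine measureReal_congr ?_
  filter_upwards [ae_le_set.2 hT] with x hx
  exact propext ⟨And.left, fun h => ⟨h, hx h⟩⟩

theorem measureReal_le_add_of_subset_union {α : Type*} [MeasurableSpace α] {μ : Measure α}
    {A B S : Set α} (h : A ⊆ B ∪ S) (hB : μ B ≠ ⊤) (hS : μ S ≠ ⊤) :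
    μ.real A ≤ μ.real B + μ.real S :=
  (measureReal_mono h (measure_union_ne_top hB hS)).trans (measureReal_union_le B S)

end VolumeInsertion

theorem mainTheorem1 {d : ℕ} (Ω : Set (EuclideanSpace ℝ (Fin d)))
    (hΩ_open : IsOpen Ω) (hΩ_bdd : Bornology.IsBounded Ω)
    (hΩ_C2 : VolumeInsertion.HasC2Boundary Ω) :
    ∃ C h₀ : ℝ, 0 < C ∧ 0 < h₀ ∧
      ∀ h : ℝ, 0 < h → h ≤ h₀ →
      ∀ T : VolumeInsertion.Mesh d, T.Covers Ω → T.Resolves Ω h →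
      ∀ p n : Fin T.numElements → EuclideanSpace ℝ (Fin d),
        (∀ e, VolumeInsertion.IsClosestBoundaryPoint Ω (T.centroid e) (p e)) →
        (∀ e, VolumeInsertion.IsOutwardUnitNormal Ω (p e) (n e)) →
        |volume.real Ω - T.insertedVolume p n| ≤ C * h ^ 2 := by
  obtain ⟨C, δ, hC, hδ, H⟩ := hΩ_C2.exists_error_set hΩ_open hΩ_bdd
  -- `C` may be zero; the theorem asks for a positive constant.
  refine ⟨C + 1, δ, by positivity, hδ, fun h h0 hh T hcov hres p n hp hn => ?_⟩
  obtain ⟨S, hS, hvol, hmem⟩ := H h h0 hh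
  have hSfin : volume S ≠ ⊤ := ne_top_of_le_ne_top ENNReal.ofReal_ne_top hvol
  have hKfin : ∀ e, volume (T.element e) ≠ ⊤ := fun e =>
    (hres.isBounded_element e).measure_lt_top.ne
  have hfin : ∀ e s, volume (T.element e ∩ s) ≠ ⊤ := fun e s =>
    measure_ne_top_of_subset inter_subset_left (hKfin e)
  have herr : ∀ e, ∀ x ∈ T.element e,
      ¬(x ∈ Ω ↔ x ∈ VolumeInsertion.halfSpace (p e) (n e)) → x ∈ S := fun e x hx hne =>
    hmem (p e) (hp e).1 (n e) (hn e) x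
      (hres.mem_closedBall hΩ_open (hp e) (hn e) hx hne) hne
  have hterm : ∀ e, |volume.real (T.element e ∩ Ω) -
      volume.real (T.element e ∩ VolumeInsertion.halfSpace (p e) (n e))| ≤
      volume.real (T.element e ∩ S) := by
    intro e
    have h1 := VolumeInsertion.measureReal_le_add_of_subset_union (μ := volume)
      (A := T.element e ∩ Ω) (B := T.element e ∩ VolumeInsertion.halfSpace (p e) (n e))
      (S := T.element e ∩ S) (fun x hx => by
        by_cases hx' : x ∈ VolumeInsertion.halfSpace (p e) (n e)
        · exact Or.inl ⟨hx.1, hx'⟩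
        · exact Or.inr ⟨hx.1, herr e x hx.1 fun hiff => hx' (hiff.1 hx.2)⟩) (hfin e _) (hfin e _)
    have h2 := VolumeInsertion.measureReal_le_add_of_subset_union (μ := volume)
      (A := T.element e ∩ VolumeInsertion.halfSpace (p e) (n e)) (B := T.element e ∩ Ω)
      (S := T.element e ∩ S) (fun x hx => by
        by_cases hx' : x ∈ Ω
        · exact Or.inl ⟨hx.1, hx'⟩
        · exact Or.inr ⟨hx.1, herr e x hx.1 fun hiff => hx' (hiff.2 hx.2)⟩) (hfin e _) (hfin e _)
    rw [abs_le]
    constructor <;> linarith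
  rw [← hcov.sum_volume_real_inter hΩ_open.measurableSet hΩ_bdd.measure_lt_top.ne,
    VolumeInsertion.Mesh.insertedVolume, ← Finset.sum_sub_distrib]
  calc _ ≤ ∑ e, |volume.real (T.element e ∩ Ω) -
      volume.real (T.element e ∩ VolumeInsertion.halfSpace (p e) (n e))| :=
        Finset.abs_sum_le_sum_abs _ _
    _ ≤ ∑ e, volume.real (T.element e ∩ S) := Finset.sum_le_sum fun e _ => hterm e
    _ = volume.real (S ∩ ⋃ e, T.element e) := T.sum_volume_real_inter hS hSfin
    _ ≤ volume.real S := measureReal_mono inter_subset_left hSfin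
    _ ≤ C * h ^ 2 := ENNReal.toReal_le_of_le_ofReal (by positivity) hvol
    _ ≤ (C + 1) * h ^ 2 := by gcongr; linarith
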